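/- For real $\alpha>0$ let $S(\alpha)=\{(x,y)\in\mathbb{R}^2 : x,y\ge 0,\ y\le \alpha x\}$. A real polynomial $p(x,y)$ is a *packing polynomial* on $S(\alpha)$ if its restriction to $S(\alpha)\cap\mathbb{N}^2$ is a bijection onto $\mathbb{N}=\{0,1,2,\dots\}$. Let $n,m$ be coprime positive integers with $m\neq 1$, and let $l=\gcd(n,m-1)$. For $c\in\mathbb{N}$, the $c$-th *staircase* of $S(n/m)$ is the set of points $(x,y)\in S(n/m)$ with $y=\frac{n}{m-1}x-c\,\frac{l}{m-1}$; the points with integer coordinates on it are its *stairs*. Two distinct stairs are *consecutive* if they lie on the same staircase and no other stair lies on the line segment joining them. For $k\in\mathbb{N}$, a *$k$-stair polynomial* on $S(n/m)$ is a polynomial $p$ of degree $2$ with real coefficients such that $p(\mathbb{Z}^2)\subseteq\mathbb{Z}$, the homogeneous quadratic part of $p$ is $\frac n2\left(x-\frac{m-1}{n}y\right)^2$, and $p(r)-p(s)=\pm k$ for any two consecutive stairs $r,s$. It is *ascending* if $p(s)-p(r)=k$ for any two consecutive stairs $r,s$ with $|r|<|s|$, where $|\cdot|$ is the Euclidean norm.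 A *(ascending) $k$-stair packing polynomial* on $S(n/m)$ is a packing polynomial on $S(n/m)$ that is a (ascending) $k$-stair polynomial on $S(n/m)$. **Theorem.** Let $n,m$ be coprime positive integers with $m\neq 1$ and $n/m>1$. 1. There is an ascending $1$-stair packing polynomial on $S(n/m)$ if and only if $n\mid (m-1)^2$ and $(m-1)\mid n$. 2. There is an ascending $2$-stair packing polynomial on $S(n/m)$ if and only if $m\equiv 9 \pmod{16}$ and $n=\frac1{16}(m-1)^2$. 3. There is an ascending $3$-stair packing polynomial on $S(n/m)$ if and only if either ($m\equiv 10$ or $19 \pmod{27}$, and $n=\frac1{27}(m-1)^2$), or $\frac nm=\frac{12}{7}$. 4. There is no $4$-stair packing polynomial on $S(n/m)$ (ascending or not). -/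

import Mathlib

noncomputable section

namespace PackingPoly

/-- The sector `S(α) = {(x, y) ∈ ℝ² | x, y ≥ 0 and y ≤ α x}`. -/
def sector (α : ℝ) : Set (ℝ × ℝ) :=
  {z | 0 ≤ z.1 ∧ 0 ≤ z.2 ∧ z.2 ≤ α * z.1}

/-- The embedding `ℕ² ⊆ ℝ²`. -/
def toPlane (z : ℕ × ℕ) : ℝ × ℝ := ((z.1 : ℝ), (z.2 : ℝ))

/-- `I = S ∩ ℕ²`. -/
def latticePoints (S : Set (ℝ × ℝ)) : Set (ℕ × ℕ) := {z | toPlane z ∈ S}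

/-- The value `p(x, y)` of a real polynomial in two variables. -/
def evalAt (p : MvPolynomial (Fin 2) ℝ) (x y : ℝ) : ℝ := MvPolynomial.eval ![x, y] p

/-- The value of `p` at a point of `ℕ²`. -/
def value (p : MvPolynomial (Fin 2) ℝ) (z : ℕ × ℕ) : ℝ := evalAt p z.1 z.2

/-- `p` is a packing polynomial on `S` if it restricts to a bijection from `S ∩ ℕ²` to `ℕ`. -/
def IsPacking (S : Set (ℝ × ℝ)) (p : MvPolynomial (Fin 2) ℝ) : Prop :=
  Set.BijOn (value p) (latticePoints S) (Set.range (Nat.cast : ℕ → ℝ))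

/-- `l = gcd(n, m - 1)`. -/
def stairGcd (n m : ℕ) : ℕ := Int.gcd (n : ℤ) ((m : ℤ) - 1)

/-- The `c`-th staircase of `I(n/m)` (for `m ≠ 1`): the part of the line
`y = n/(m-1) * x - c * l/(m-1)` that lies in the sector `S(n/m)`. -/
def staircase (n m c : ℕ) : Set (ℝ × ℝ) :=
  {z | z ∈ sector ((n : ℝ) / m) ∧
    z.2 = (n : ℝ) / ((m : ℝ) - 1) * z.1 - c * ((stairGcd n m : ℝ) / ((m : ℝ) - 1))}

/-- `S_c`, the set of stairs (points with integer coordinates) on the `c`-th staircase. -/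
def stairs (n m c : ℕ) : Set (ℕ × ℕ) := latticePoints (staircase n m c)

/-- Two (distinct) stairs are consecutive if they are on the same staircase and there is no other
stair on the line segment joining them. -/
def Consecutive (n m : ℕ) (r s : ℕ × ℕ) : Prop :=
  r ≠ s ∧ ∃ c : ℕ, r ∈ stairs n m c ∧ s ∈ stairs n m c ∧
    ∀ t ∈ stairs n m c, toPlane t ∈ segment ℝ (toPlane r) (toPlane s) → t = r ∨ t = s

/-- The Euclidean length `|r|`. -/
def length (r : ℕ × ℕ) : ℝ := √((r.1 : ℝ) ^ 2 + (r.2 : ℝ) ^ 2)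

/-- `p` is a `k`-stair polynomial on `S(n/m)`: a quadratic polynomial, integer-valued on `ℤ²`, with
homogeneous quadratic part `(n/2) (x - ((m-1)/n) y)²`, whose values at any two consecutive stairs
differ by `± k`. -/
structure IsStair (n m k : ℕ) (p : MvPolynomial (Fin 2) ℝ) : Prop where
  totalDegree_eq : p.totalDegree = 2
  quadraticPart_eq : MvPolynomial.homogeneousComponent 2 p =
    MvPolynomial.C ((n : ℝ) / 2) *
      (MvPolynomial.X 0 - MvPolynomial.C (((m : ℝ) - 1) / n) * MvPolynomial.X 1) ^ 2
  integerValued : ∀ x y : ℤ, ∃ w : ℤ, evalAt p x y = w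
  step : ∀ r s : ℕ × ℕ, Consecutive n m r s →
    value p r - value p s = k ∨ value p r - value p s = -(k : ℝ)

/-- A `k`-stair polynomial is ascending if `p(s) - p(r) = k` for consecutive stairs `r`, `s` with
`|r| < |s|`. -/
def IsAscendingStair (n m k : ℕ) (p : MvPolynomial (Fin 2) ℝ) : Prop :=
  IsStair n m k p ∧
    ∀ r s : ℕ × ℕ, Consecutive n m r s → length r < length s → value p s - value p r = k

end PackingPoly

end

/-! Integrality of `p` forces n ∣ (m-1)², hence n = N²Q and m - 1 = NAQ with N, A coprime and A < N
(`SectorShape.exists`). In the coordinate c = Nx - Ay the quadratic part is Qc²/2 and the c-th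
staircase is the level set c. It carries Qc + [N ∣ c] stairs, at heights r c, r c + N, …, where r c
is the residue of -c/A modulo N. Along a staircase `p` is affine in y, so its values form an
arithmetic progression of step ±k, and packing means that these progressions tile ℕ.

In an ascending tiling the value just past the end of one progression starts another, and quadratic
growth shows that for large c this is the one k places later. Comparing formulas, r (c+k) - r c
equals N[N ∣ c] minus a constant, and summing over a period shows that the constant is 1. Hence N ∣
k - A, the linear coefficient is forced, and continuation after k places holds for every c
(`ProgressionTiling.rigidity`, `next_of_formula`). Conversely, such continuation gives a tiling once
the first k starts are a permutation of 0, …, k-1 (`ProgressionTiling.of_next`).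

What remains is a finite condition on b c = b 0 - Qc(k-c)/2 + t with t = (c + k r c)/N, for 0 < c <
k. It is empty for k = 1, forces Q = 4 for k = 2 and Q = 3 for k = 3, and fails for k = 4. Since A <
N, the divisibility N ∣ k - A gives A = k if N > k; among N ≤ k ≤ 3 only 12/7 survives. Descending
polynomials reduce to the same analysis by reading each staircase from its far end, which replaces A
by -A. -/

namespace PackingPoly

/-! ### Tilings of ℕ by arithmetic progressions -/

/-- The arithmetic progressions `b c, b c + k, …, b c + k (L c - 1)` partition `ℕ`. -/
structure ProgressionTiling (k : ℕ) (b : ℕ → ℤ) (L : ℕ → ℕ) : Prop where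
  nonneg : ∀ c j, j < L c → 0 ≤ b c + k * j
  surj : ∀ v : ℕ, ∃ c j, j < L c ∧ b c + k * j = v
  inj : ∀ c j c' j', j < L c → j' < L c' → b c + k * j = b c' + k * j' → c = c' ∧ j = j'

namespace ProgressionTiling

variable {k : ℕ} {b : ℕ → ℤ} {L : ℕ → ℕ}

/-- The value following the last term of a progression is the first term of another one. -/
theorem exists_next (h : ProgressionTiling k b L) {c : ℕ} (hL : 0 < L c) :
    ∃ c', b c' = b c + k * L c := by
  have h0 := h.nonneg c 0 hL
  have hk : (0 : ℤ) ≤ k * L c := by positivity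
  obtain ⟨c', j, hj, hv⟩ := h.surj (b c + k * L c).toNat
  rw [Int.toNat_of_nonneg (by push_cast at h0; linarith)] at hv
  rcases Nat.eq_zero_or_pos j with rfl | hpos
  · exact ⟨c', by simpa using hv⟩
  -- At a positive index, the preceding term would equal the last term of progression `c`, against
  -- injectivity.
  · obtain ⟨i, rfl⟩ : ∃ i, j = i + 1 := ⟨j - 1, by omega⟩
    obtain ⟨l, hl⟩ : ∃ l, L c = l + 1 := ⟨L c - 1, by omega⟩
    have := h.inj c' i c l (by omega) (by omega) (by
      rw [hl] at hv; push_cast at hv; linarith)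
    obtain ⟨rfl, rfl⟩ := this
    omega

/-- The start reached from c exceeds b c by kQc + O(1), as does b (c + k); since starts grow
quadratically, neighbouring indices are too far apart for large c to be confused. -/
theorem eventually_next (h : ProgressionTiling k b L) {Q : ℕ} (hQ : 0 < Q) {β δ : ℝ}
    (hLpos : ∀ c, 0 < L c) (hL : ∀ c, Q * c ≤ L c) (hL' : ∀ c, L c ≤ Q * c + 1)
    (hb : ∀ c : ℕ, (Q : ℝ) / 2 * c ^ 2 + β * c + δ ≤ b c)
    (hb' : ∀ c : ℕ, (b c : ℝ) ≤ (Q : ℝ) / 2 * c ^ 2 + β * c + δ + k) :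
    ∃ C : ℕ, ∀ c ≥ C, b (c + k) = b c + k * L c := by
  -- Chosen so that c/2 - |β|, a lower bound for `w` below, exceeds the bound on |d * w|.
  obtain ⟨C, hC⟩ := exists_nat_gt (2 * (2 * k + Q * (k : ℝ) ^ 2 / 2 + |β| * k + |β|))
  refine ⟨C, fun c hc => ?_⟩
  obtain ⟨c', hc'⟩ := h.exists_next (hLpos c)
  suffices c' = c + k by rw [← this, hc']
  by_contra hne
  have e : (b c' : ℝ) = b c + k * L c := by exact_mod_cast hc'
  have hk : (0 : ℝ) ≤ k := by positivity
  have l1 : (Q : ℝ) * c ≤ L c := by exact_mod_cast hL c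
  have l2 : (L c : ℝ) ≤ Q * c + 1 := by exact_mod_cast hL' c
  have l3 := mul_le_mul_of_nonneg_left l1 hk
  have l4 := mul_le_mul_of_nonneg_left l2 hk
  have hQ1 : (1 : ℝ) ≤ Q := by exact_mod_cast hQ
  have hcC : (C : ℝ) ≤ c := by exact_mod_cast hc
  have hβ := abs_le.mp (le_refl |β|)
  have hβk : |β * k| = |β| * k := by rw [abs_mul, abs_of_nonneg hk]
  have hβ' := abs_le.mp hβk.le
  set d : ℝ := (c' : ℝ) - (c + k) with hd
  set w : ℝ := (Q : ℝ) / 2 * (c' + (c + k)) + β with hw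
  have hdw : d * w = ((Q : ℝ) / 2 * c' ^ 2 + β * c') -
      ((Q : ℝ) / 2 * c ^ 2 + β * c) - k * (Q * c) - (Q * (k : ℝ) ^ 2 / 2 + β * k) := by
    rw [hd, hw]; ring
  have hup : |d * w| ≤ 2 * k + Q * (k : ℝ) ^ 2 / 2 + |β| * k := by
    have hq : 0 ≤ (Q : ℝ) * (k : ℝ) ^ 2 / 2 := by positivity
    have := hb c; have := hb' c; have := hb c'; have := hb' c'
    rw [abs_le, hdw]
    constructor <;> linarith [hβ'.1, hβ'.2]
  have hw' : 2 * k + Q * (k : ℝ) ^ 2 / 2 + |β| * k < w := by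
    have h1 : (c : ℝ) ≤ Q * (c' + (c + k)) := by
      have : (0 : ℝ) ≤ c' := by positivity
      nlinarith
    rw [hw]; linarith [hβ.1]
  have hd1 : 1 ≤ |d| := by
    have : (1 : ℤ) ≤ |(c' : ℤ) - (c + k)| := Int.one_le_abs (by omega)
    rw [hd]; exact_mod_cast this
  rw [abs_mul] at hup
  nlinarith [le_abs_self w, abs_nonneg w]

/-- Progressions in which every one is continued by the one `k` places later tile `ℕ` as soon as
the first terms of the first `k` ones are the numbers below `k`. -/
theorem of_next (hk : 0 < k) (hL : ∀ c, 0 < L c) (hb : ∀ c, b (c + k) = b c + k * L c)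
    (hmem : ∀ c < k, 0 ≤ b c ∧ b c < k) (hinj : ∀ c < k, ∀ c' < k, b c = b c' → c = c') :
    ProgressionTiling k b L := by
  have hkz : (0 : ℤ) < k := by exact_mod_cast hk
  -- the position of a term within its residue class
  let T : ℕ → ℕ → ℕ := fun a s => ∑ i ∈ Finset.range s, L (a + k * i)
  have hT : ∀ a s, b (a + k * s) = b a + k * T a s := by
    intro a s
    induction s with
    | zero => simp [T]
    | succ s ih =>
      rw [show a + k * (s + 1) = a + k * s + k by ring, hb, ih]
      simp only [T, Finset.sum_range_succ]; push_cast; ring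
  have hTsucc : ∀ a s, T a (s + 1) = T a s + L (a + k * s) := fun a s => by
    simp only [T, Finset.sum_range_succ]
  have hTmono : ∀ a, StrictMono (T a) := fun a =>
    strictMono_nat_of_lt_succ fun s => by rw [hTsucc]; have := hL (a + k * s); omega
  have hTdisj : ∀ a s s' j j', j < L (a + k * s) → T a s + j = T a s' + j' → s' ≤ s := by
    intro a s s' j j' hj he
    by_contra hlt
    have := (hTmono a).monotone (show s + 1 ≤ s' by omega)
    rw [hTsucc] at this
    omega
  have hsplit : ∀ c, ∃ a s, a < k ∧ c = a + k * s := fun c =>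
    ⟨c % k, c / k, Nat.mod_lt _ hk, (Nat.mod_add_div c k).symm⟩
  refine ⟨?_, ?_, ?_⟩
  · intro c j _
    obtain ⟨a, s, ha, rfl⟩ := hsplit c
    rw [hT]
    have := (hmem a ha).1
    positivity
  · intro v
    have hsurj : ∃ a < k, b a = (v % k : ℕ) := by
      let f : Fin k → Fin k := fun a => ⟨(b a).toNat, by
        have := hmem a a.2; omega⟩
      have hf : Function.Injective f := by
        intro a a' haa
        have h1 := hmem a a.2
        have h2 := hmem a' a'.2
        have h3 : (b a).toNat = (b a').toNat := congrArg Fin.val haa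
        exact Fin.ext (hinj a a.2 a' a'.2 (by omega))
      obtain ⟨a, ha⟩ := (Finite.injective_iff_surjective.mp hf) ⟨v % k, Nat.mod_lt _ hk⟩
      have h3 : (b a).toNat = v % k := congrArg Fin.val ha
      have := hmem a a.2
      exact ⟨a, a.2, by omega⟩
    obtain ⟨a, ha, hba⟩ := hsurj
    -- The block containing v is the first in its class whose end passes v / k.
    have hex : ∃ s, v / k < T a (s + 1) :=
      ⟨v / k, by have := (hTmono a).id_le (v / k + 1); simp only [id] at this; omega⟩
    classical
    have hspec := Nat.find_spec hex
    have hle : T a (Nat.find hex) ≤ v / k := by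
      rcases Nat.eq_zero_or_pos (Nat.find hex) with h0 | hpos
      · rw [h0]; simp [T]
      · have := Nat.find_min hex (m := Nat.find hex - 1) (by omega)
        rw [show Nat.find hex - 1 + 1 = Nat.find hex by omega] at this
        omega
    rw [hTsucc] at hspec
    refine ⟨a + k * Nat.find hex, v / k - T a (Nat.find hex), by omega, ?_⟩
    rw [hT, hba]
    push_cast [Nat.cast_sub hle]
    have := Int.emod_add_mul_ediv (v : ℤ) k
    linarith
  · intro c j c' j' hj hj' he
    obtain ⟨a, s, ha, rfl⟩ := hsplit c
    obtain ⟨a', s', ha', rfl⟩ := hsplit c'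
    rw [hT, hT] at he
    have haa : a = a' := by
      apply hinj a ha a' ha'
      have h1 := hmem a ha
      have h2 := hmem a' ha'
      have h3 : b a % k = b a' % k := by
        have := congrArg (· % (k : ℤ)) he
        simpa [add_assoc, ← mul_add] using this
      rwa [Int.emod_eq_of_lt h1.1 h1.2, Int.emod_eq_of_lt h2.1 h2.2] at h3
    subst haa
    have h4 : (k : ℤ) * ((T a s + j : ℕ) : ℤ) = k * ((T a s' + j' : ℕ) : ℤ) := by
      push_cast; linarith
    have h5 : T a s + j = T a s' + j' := by
      exact_mod_cast mul_left_cancel₀ hkz.ne' h4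
    have h6 := hTdisj a s s' j j' hj h5
    have h7 := hTdisj a s' s j' j hj' h5.symm
    have h8 : s = s' := le_antisymm h7 h6
    subst h8
    exact ⟨rfl, by omega⟩

end ProgressionTiling

/-! ### Residues modulo N and rigidity of the tiling -/

theorem sum_range_add_of_periodic {r : ℕ → ℕ} {N : ℕ} (hr : ∀ c, r (c + N) = r c) (k : ℕ) :
    ∑ c ∈ Finset.range N, r (c + k) = ∑ c ∈ Finset.range N, r c := by
  induction k with
  | zero => rfl
  | succ k ih =>
    rw [← ih]
    have h1 := Finset.sum_range_succ (fun c => r (c + k)) N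
    rw [Finset.sum_range_succ' (fun c => r (c + k)) N] at h1
    rw [show N + k = 0 + k + N by ring, hr] at h1
    simp only [add_right_comm _ 1 k] at h1
    simpa [add_assoc] using h1

/-- `r c` is the residue modulo `N` of `-c / A`. -/
structure ResidueSystem (N : ℕ) (A : ℤ) (r : ℕ → ℕ) : Prop where
  pos : 0 < N
  coprime : IsCoprime (N : ℤ) A
  lt : ∀ c, r c < N
  dvd : ∀ c : ℕ, (N : ℤ) ∣ c + A * r c

namespace ResidueSystem

variable {N : ℕ} {A : ℤ} {r : ℕ → ℕ}

theorem eq_of_dvd (h : ResidueSystem N A r) {c y : ℕ} (hy : y < N) (hd : (N : ℤ) ∣ c + A * y) :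
    y = r c := by
  have h1 : (N : ℤ) ∣ A * (y - r c) := by
    have := dvd_sub hd (h.dvd c)
    rwa [show (c : ℤ) + A * y - (c + A * r c) = A * (y - r c) by ring] at this
  have h2 := h.coprime.dvd_of_dvd_mul_left h1
  have h3 := h.lt c
  have h4 := Int.eq_zero_of_abs_lt_dvd h2 (by rw [abs_lt]; omega)
  omega

theorem periodic (h : ResidueSystem N A r) (c : ℕ) : r (c + N) = r c := by
  apply h.eq_of_dvd (h.lt _)
  have := h.dvd (c + N)
  push_cast at this
  rw [show (c : ℤ) + N + A * r (c + N) = c + A * r (c + N) + N by ring] at this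
  exact (dvd_add_left (dvd_refl _)).mp this

theorem periodic_mul (h : ResidueSystem N A r) (c s : ℕ) : r (c + N * s) = r c := by
  induction s with
  | zero => rfl
  | succ s ih => rw [mul_add, mul_one, ← add_assoc, h.periodic, ih]

theorem eq_zero_iff (h : ResidueSystem N A r) (c : ℕ) : r c = 0 ↔ N ∣ c := by
  constructor
  · intro h0
    have := h.dvd c
    rw [h0] at this
    simpa [Int.natCast_dvd_natCast] using this
  · intro hc
    exact (h.eq_of_dvd h.pos (by simpa [Int.natCast_dvd_natCast] using hc)).symm

end ResidueSystem

/-- The number of stairs on the `c`-th staircase. -/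
def stairCount (N Q c : ℕ) : ℕ := Q * c + if N ∣ c then 1 else 0

theorem stairCount_pos {N Q : ℕ} (hQ : 0 < Q) (c : ℕ) : 0 < stairCount N Q c := by
  unfold stairCount
  rcases Nat.eq_zero_or_pos c with rfl | h
  · simp
  · have := Nat.mul_pos hQ h
    omega

/-- A tiling by progressions starting at values of a quadratic quasi-polynomial determines the
linear coefficient and the slope modulo `N`. -/
theorem ProgressionTiling.rigidity {N Q k : ℕ} {A : ℤ} {r : ℕ → ℕ} {b : ℕ → ℤ} {β δ : ℝ}
    (hN : 2 ≤ N) (hQ : 0 < Q) (hr : ResidueSystem N A r)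
    (hb : ∀ c : ℕ, (b c : ℝ) = (Q : ℝ) / 2 * c ^ 2 + β * c + k * r c / N + δ)
    (h : ProgressionTiling k b (stairCount N Q)) :
    (N : ℤ) ∣ k - A ∧
      ∀ c : ℕ, N * (2 * b c) = (N : ℤ) * Q * c * (c - k) + 2 * (c + k * r c) + N * (2 * b 0) := by
  have hN0 : (0 : ℝ) < N := by exact_mod_cast hr.pos
  -- A zero step would repeat a value on staircase N, which has at least two stairs.
  rcases Nat.eq_zero_or_pos k with rfl | hk
  · obtain ⟨_, h2⟩ := h.inj 1 0 1 0
      (stairCount_pos hQ 1) (stairCount_pos hQ 1) rfl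
    exfalso
    have hcount : 1 < stairCount N Q N := by
      unfold stairCount
      have := Nat.mul_pos hQ hr.pos
      simp; omega
    have := (h.inj N 0 N 1 (by omega) hcount (by simp)).2
    omega
  have hkr : (0 : ℝ) < k := by exact_mod_cast hk
  have hfrac : ∀ c, (0 : ℝ) ≤ k * r c / N ∧ (k * r c / N : ℝ) ≤ k := by
    intro c
    refine ⟨by positivity, ?_⟩
    rw [div_le_iff₀ hN0]
    have : (r c : ℝ) ≤ N := by exact_mod_cast (hr.lt c).le
    gcongr
  obtain ⟨C, hC⟩ := h.eventually_next hQ (β := β) (δ := δ) (stairCount_pos hQ)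
    (fun c => by unfold stairCount; omega)
    (fun c => by unfold stairCount; split_ifs <;> omega)
    (fun c => by rw [hb]; linarith [(hfrac c).1])
    (fun c => by rw [hb]; linarith [(hfrac c).2])
  -- Periodicity of r transfers the relation from c + NC, where continuation is known, to every c.
  have key : ∀ c : ℕ, (r (c + k) : ℝ) =
      r c + N * (if N ∣ c then 1 else 0) - N * (Q * k / 2 + β) := by
    intro c
    have h1 := hC (c + N * C) (by nlinarith [hr.pos])
    have h2 : (b (c + N * C + k) : ℝ) = b (c + N * C) + k * stairCount N Q (c + N * C) := by
      exact_mod_cast h1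
    rw [hb, hb, stairCount, add_right_comm c, hr.periodic_mul, hr.periodic_mul] at h2
    have hdvd : N ∣ c + N * C ↔ N ∣ c := (Nat.dvd_add_left (Dvd.intro _ rfl))
    simp only [hdvd] at h2
    push_cast at h2
    have h3 : (k : ℝ) * (Q * k / 2 + β + r (c + k) / N - r c / N -
      (if N ∣ c then 1 else 0)) = 0 := by linear_combination h2
    have h4 := (mul_eq_zero.mp h3).resolve_left hkr.ne'
    field_simp at h4 ⊢
    linarith
  -- Over a full period the shift by k leaves the sum of r unchanged, and N ∣ c occurs exactly once.
  have hsum : (N : ℝ) * (Q * k / 2 + β) = 1 := by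
    have h1 : ∑ c ∈ Finset.range N, (r (c + k) : ℝ) = ∑ c ∈ Finset.range N, (r c : ℝ) := by
      exact_mod_cast sum_range_add_of_periodic hr.periodic k
    simp only [key, Finset.sum_sub_distrib, Finset.sum_add_distrib, ← Finset.mul_sum] at h1
    have h2 : ∑ c ∈ Finset.range N, (if N ∣ c then (1 : ℝ) else 0) = 1 := by
      rw [Finset.sum_eq_single 0]
      · simp
      · intro c hc hc0
        rw [if_neg]
        intro hd
        have := Nat.le_of_dvd (by omega) hd
        simp at hc; omega
      · simp; omega
    rw [h2] at h1
    simp only [Finset.sum_const, Finset.card_range, nsmul_eq_mul] at h1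
    have h3 : (N : ℝ) * (1 - N * (Q * k / 2 + β)) = 0 := by linarith
    have := (mul_eq_zero.mp h3).resolve_left hN0.ne'
    linarith
  have hr0 : r 0 = 0 := (hr.eq_zero_iff 0).mpr (dvd_zero _)
  constructor
  · have h1 := key 0
    rw [hsum, hr0] at h1
    simp at h1
    have h2 : (r k : ℤ) = N - 1 := by
      have : ((r k : ℤ) : ℝ) = ((N - 1 : ℤ) : ℝ) := by push_cast; exact h1
      exact_mod_cast this
    have h3 := hr.dvd k
    rw [h2, show (k : ℤ) + A * (N - 1) = k - A + N * A by ring] at h3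
    exact (dvd_add_left (Dvd.intro _ rfl)).mp h3
  · intro c
    have h1 := hb c
    have h0 := hb 0
    rw [hr0] at h0
    simp at h0
    have : (N : ℝ) * (2 * b c) = (N : ℝ) * Q * c * (c - k) + 2 * (c + k * r c) + N * (2 * b 0) := by
      rw [h1, h0]
      field_simp
      linear_combination (2 * (c : ℝ)) * hsum
    exact_mod_cast this

/-- As k ≡ A modulo N, moving k places lowers r by 1, wrapping from 0 to N - 1 exactly when N ∣ c;
the wrap accounts for the extra stair. -/
theorem next_of_formula {N Q k : ℕ} {A : ℤ} {r : ℕ → ℕ} {b : ℕ → ℤ} {δ : ℤ}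
    (hr : ResidueSystem N A r) (hA : (N : ℤ) ∣ k - A)
    (hb : ∀ c : ℕ, N * (2 * b c) = (N : ℤ) * Q * c * (c - k) + 2 * (c + k * r c) + N * (2 * δ))
    (c : ℕ) : b (c + k) = b c + k * stairCount N Q c := by
  have h1 := hb c
  have h2 := hb (c + k)
  have hN : (N : ℤ) ≠ 0 := by have := hr.pos; omega
  have key : (r (c + k) : ℤ) = r c - 1 + N * (if N ∣ c then 1 else 0) := by
    by_cases hc : N ∣ c
    · have h0 := (hr.eq_zero_iff c).mpr hc
      have := hr.eq_of_dvd (c := c + k) (y := N - 1) (by have := hr.pos; omega) (by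
        have hc' : (N : ℤ) ∣ c := by exact_mod_cast hc
        push_cast [Nat.cast_sub hr.pos]
        rw [show (c : ℤ) + k + A * (N - 1) = c + (k - A) + N * A by ring]
        exact dvd_add (dvd_add hc' hA) (Dvd.intro _ rfl))
      rw [← this, h0, if_pos hc]
      have := hr.pos
      omega
    · have h0 : r c ≠ 0 := fun h => hc ((hr.eq_zero_iff c).mp h)
      have := hr.eq_of_dvd (c := c + k) (y := r c - 1) (by have := hr.lt c; omega) (by
        push_cast [Nat.cast_sub (Nat.one_le_iff_ne_zero.mpr h0)]
        rw [show (c : ℤ) + k + A * (r c - 1) = (c + A * r c) + (k - A) by ring]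
        exact dvd_add (hr.dvd c) hA)
      rw [← this, if_neg hc]
      omega
  rw [key] at h2
  push_cast at h2
  have h3 : (2 * N : ℤ) * b (c + k) = (2 * N) * (b c + k * stairCount N Q c) := by
    unfold stairCount
    push_cast
    linear_combination h2 - h1
  exact mul_left_cancel₀ (by simpa using hN) h3

/-- The numbers below `k` are the first terms of the first `k` progressions. -/
theorem ProgressionTiling.exists_first {k : ℕ} {b : ℕ → ℤ} {L : ℕ → ℕ}
    (h : ProgressionTiling k b L) (hL : ∀ c, 0 < L c)
    (hb : ∀ c, b (c + k) = b c + k * L c) {v : ℕ} (hv : v < k) : ∃ c < k, b c = v := by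
  obtain ⟨c, j, hj, he⟩ := h.surj v
  have h0 := h.nonneg c 0 (hL c)
  have hj0 : j = 0 := by
    by_contra hne
    have : (k : ℤ) * 1 ≤ k * j := by gcongr; omega
    push_cast at h0
    omega
  subst hj0
  refine ⟨c, ?_, by simpa using he⟩
  by_contra hge
  obtain ⟨d, rfl⟩ := Nat.exists_eq_add_of_le' (not_lt.mp hge)
  have h1 := h.nonneg d 0 (hL d)
  rw [hb] at he
  have : (k : ℤ) * 1 ≤ k * L d := by gcongr; exact_mod_cast hL d
  push_cast at h1 he
  omega

theorem ResidueSystem.exists {N : ℕ} {A : ℤ} (hN : 0 < N) (h : IsCoprime (N : ℤ) A) :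
    ∃ r, ResidueSystem N A r := by
  obtain ⟨u, v, huv⟩ := h
  have hNz : (0 : ℤ) < N := by exact_mod_cast hN
  have hnn : ∀ c : ℕ, 0 ≤ (-(c : ℤ) * v) % N := fun c => Int.emod_nonneg _ hNz.ne'
  refine ⟨fun c => ((-(c : ℤ) * v) % N).toNat, hN, ⟨u, v, huv⟩, fun c => ?_, fun c => ?_⟩
  · have := Int.emod_lt_of_pos (-(c : ℤ) * v) hNz
    have := hnn c
    omega
  · rw [Int.toNat_of_nonneg (hnn c), Int.emod_def]
    exact ⟨c * u - A * (-(c : ℤ) * v / N), by linear_combination (-(c : ℤ)) * huv⟩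

/-- Serves descending polynomials, where the staircases are read from the far end. -/
theorem ResidueSystem.neg {N : ℕ} {A : ℤ} {r : ℕ → ℕ} (h : ResidueSystem N A r) :
    ResidueSystem N (-A) (fun c => if N ∣ c then 0 else N - r c) := by
  refine ⟨h.pos, h.coprime.neg_right, fun c => ?_, fun c => ?_⟩
  · have h0 := h.eq_zero_iff c
    have := h.pos
    split_ifs with hc
    · exact h.pos
    · have : r c ≠ 0 := fun e => hc (h0.mp e)
      omega
  · split_ifs with hc
    · simpa [Int.natCast_dvd_natCast] using hc
    · rw [Nat.cast_sub (h.lt c).le,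
        show (c : ℤ) + -A * ((N : ℤ) - r c) = (c + A * r c) + N * (-A) by ring]
      exact dvd_add (h.dvd c) (Dvd.intro _ rfl)

/-! ### Arithmetic of the sector and geometry of its staircases -/

/-- The arithmetic shape `n = N² Q`, `m = N A Q + 1` of a sector that carries a stair polynomial. -/
structure SectorShape (n m N A Q : ℕ) : Prop where
  two_le : 2 ≤ N
  pos : 0 < A
  lt : A < N
  coprime : N.Coprime A
  mult_pos : 0 < Q
  num_eq : n = N ^ 2 * Q
  den_eq : m = N * A * Q + 1

theorem SectorShape.exists {n m : ℕ} (hm : 2 ≤ m) (hnm : m < n) (hdvd : n ∣ (m - 1) ^ 2) :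
    ∃ N A Q, SectorShape n m N A Q := by
  obtain ⟨a, rfl⟩ : ∃ a, m = a + 1 := ⟨m - 1, by omega⟩
  simp only [Nat.add_sub_cancel] at hdvd
  obtain ⟨g, N, A, hg, hcop, hn, ha⟩ := Nat.exists_coprime' (m := n) (n := a) (Nat.gcd_pos_of_pos_left _ (by omega))
  -- Here g = gcd(n, m - 1), so gN ∣ g²A² and N is coprime to A.
  have hd : N ∣ g := by
    rw [hn, ha] at hdvd
    have h1 : g * N ∣ g * (g * A ^ 2) := by
      convert hdvd using 1 <;> ring
    have h2 := Nat.dvd_of_mul_dvd_mul_left hg h1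
    exact (Nat.Coprime.pow_right 2 hcop).dvd_of_dvd_mul_right h2
  obtain ⟨Q, rfl⟩ := hd
  have hN : 0 < N := Nat.pos_of_mul_pos_right hg
  have hQ : 0 < Q := Nat.pos_of_mul_pos_left hg
  have hA : 0 < A := by
    rcases Nat.eq_zero_or_pos A with rfl | h
    · simp at ha; omega
    · exact h
  have hlt : A < N := by
    have : A * (N * Q) < N * (N * Q) := by omega
    exact Nat.lt_of_mul_lt_mul_right this
  exact ⟨N, A, Q, by omega, hA, hlt, hcop, hQ, by rw [hn]; ring, by rw [ha]; ring⟩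

theorem mem_latticePoints_sector {n m : ℕ} (hm : 0 < m) (z : ℕ × ℕ) :
    z ∈ latticePoints (sector ((n : ℝ) / m)) ↔ m * z.2 ≤ n * z.1 := by
  have hm' : (0 : ℝ) < m := by exact_mod_cast hm
  simp only [latticePoints, sector, toPlane, Set.mem_ofPred_eq, Nat.cast_nonneg, true_and]
  rw [div_mul_eq_mul_div, le_div_iff₀ hm', mul_comm]
  exact_mod_cast Iff.rfl

/-- The `j`-th stair on the `c`-th staircase. -/
def stairPoint (N A : ℕ) (r : ℕ → ℕ) (c j : ℕ) : ℕ × ℕ :=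
  ((c + A * r c) / N + A * j, r c + N * j)

theorem stairPoint_spec {N A : ℕ} {r : ℕ → ℕ} (hr : ResidueSystem N A r) (c j : ℕ) :
    N * (stairPoint N A r c j).1 = c + A * (stairPoint N A r c j).2 := by
  have hd : N ∣ c + A * r c := by exact_mod_cast hr.dvd c
  simp only [stairPoint, mul_add, Nat.mul_div_cancel' hd]
  ring

namespace SectorShape

variable {n m N A Q : ℕ} {r : ℕ → ℕ}

theorem stairGcd_eq (h : SectorShape n m N A Q) : stairGcd n m = N * Q := by
  unfold stairGcd
  rw [h.num_eq, h.den_eq, show ((N ^ 2 * Q : ℕ) : ℤ) = ((N * Q * N : ℕ) : ℤ) by push_cast; ring,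
    show ((N * A * Q + 1 : ℕ) : ℤ) - 1 = ((N * Q * A : ℕ) : ℤ) by push_cast; ring,
    Int.gcd_natCast_natCast, Nat.gcd_mul_left, h.coprime, mul_one]

theorem mem_stairs (h : SectorShape n m N A Q) (c : ℕ) (z : ℕ × ℕ) :
    z ∈ stairs n m c ↔ m * z.2 ≤ n * z.1 ∧ N * z.1 = c + A * z.2 := by
  have hm : 0 < m := by rw [h.den_eq]; omega
  rw [← mem_latticePoints_sector hm]
  simp only [stairs, staircase, latticePoints, Set.mem_ofPred_eq, toPlane]
  refine and_congr_right fun _ => ?_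
  have hN : (0 : ℝ) < N := by have := h.two_le; exact_mod_cast (by omega : 0 < N)
  have hA : (0 : ℝ) < A := by exact_mod_cast h.pos
  have hQ : (0 : ℝ) < Q := by exact_mod_cast h.mult_pos
  rw [h.stairGcd_eq, h.num_eq, h.den_eq]
  push_cast
  rw [add_sub_cancel_right, ← Nat.cast_inj (R := ℝ)]
  push_cast
  field_simp
  constructor <;> intro e <;> linarith

theorem mem_stairs_iff (h : SectorShape n m N A Q) (hr : ResidueSystem N A r) (c : ℕ)
    (z : ℕ × ℕ) :
    z ∈ stairs n m c ↔ ∃ j < stairCount N Q c, z = stairPoint N A r c j := by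
  rw [h.mem_stairs]
  -- Substituting Nx = c + Ay, the terms NQAy cancel from my ≤ nx.
  have hbound : ∀ z : ℕ × ℕ, N * z.1 = c + A * z.2 → (m * z.2 ≤ n * z.1 ↔ z.2 ≤ N * Q * c) := by
    intro z hz
    rw [h.num_eq, h.den_eq, show N ^ 2 * Q * z.1 = N * Q * (N * z.1) by ring, hz]
    constructor <;> intro e <;> nlinarith
  have hcount : ∀ j, r c + N * j ≤ N * Q * c ↔ j < stairCount N Q c := by
    intro j
    have h0 := hr.eq_zero_iff c
    have hlt := hr.lt c
    unfold stairCount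
    rw [mul_assoc]
    split_ifs with hc
    · rw [h0.mpr hc, zero_add, Nat.lt_succ_iff]
      exact Nat.mul_le_mul_left_iff hr.pos
    · have hpos : 0 < r c := Nat.pos_of_ne_zero fun e => hc (h0.mp e)
      rw [add_zero]
      constructor
      · intro e
        exact Nat.lt_of_mul_lt_mul_left (a := N) (by omega)
      · intro e
        have : N * (j + 1) ≤ N * (Q * c) := Nat.mul_le_mul_left _ (by omega)
        rw [mul_add] at this
        omega
  constructor
  · rintro ⟨h1, h2⟩
    have hres : z.2 % N = r c := by
      apply hr.eq_of_dvd (Nat.mod_lt _ hr.pos)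
      have e : (N : ℤ) * z.1 = c + A * z.2 := by exact_mod_cast h2
      push_cast
      rw [Int.emod_def]
      exact ⟨z.1 - A * (z.2 / N), by linear_combination -e⟩
    have hz2 : z.2 = r c + N * (z.2 / N) := by rw [← hres, Nat.mod_add_div]
    have hj : z.2 / N < stairCount N Q c := by
      rw [← hcount, ← hz2]
      exact (hbound z h2).mp h1
    refine ⟨z.2 / N, hj, Prod.ext ?_ hz2⟩
    have := stairPoint_spec hr c (z.2 / N)
    rw [show (stairPoint N A r c (z.2 / N)).2 = z.2 from hz2.symm, ← h2] at this
    exact (Nat.eq_of_mul_eq_mul_left hr.pos this).symm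
  · rintro ⟨j, hj, rfl⟩
    have hs := stairPoint_spec hr c j
    exact ⟨(hbound _ hs).mpr ((hcount j).mpr hj), hs⟩

theorem mem_sector_iff (h : SectorShape n m N A Q) (hr : ResidueSystem N A r) (z : ℕ × ℕ) :
    z ∈ latticePoints (sector ((n : ℝ) / m)) ↔
      ∃ c, ∃ j < stairCount N Q c, z = stairPoint N A r c j := by
  have hm : 0 < m := by rw [h.den_eq]; omega
  simp only [← h.mem_stairs_iff hr, h.mem_stairs, mem_latticePoints_sector hm]
  constructor
  · intro hz
    refine ⟨N * z.1 - A * z.2, hz, ?_⟩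
    have : A * z.2 ≤ N * z.1 := by
      rw [h.num_eq, h.den_eq] at hz
      have hNQ : 0 < N * Q := Nat.mul_pos hr.pos h.mult_pos
      refine le_of_mul_le_mul_left (a := N * Q) ?_ hNQ
      nlinarith
    omega
  · rintro ⟨c, hz, _⟩
    exact hz

theorem stairPoint_inj (hr : ResidueSystem N A r) {c j c' j' : ℕ}
    (e : stairPoint N A r c j = stairPoint N A r c' j') : c = c' ∧ j = j' := by
  have h1 := stairPoint_spec hr c j
  have h2 := stairPoint_spec hr c' j'
  rw [e] at h1
  have hc : c = c' := by omega
  subst hc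
  have h3 := congrArg Prod.snd e
  simp only [stairPoint] at h3
  exact ⟨rfl, Nat.eq_of_mul_eq_mul_left hr.pos (by omega)⟩

theorem consecutive_iff (h : SectorShape n m N A Q) (hr : ResidueSystem N A r) (x y : ℕ × ℕ) :
    Consecutive n m x y ↔ ∃ c j, j + 1 < stairCount N Q c ∧
      (x = stairPoint N A r c j ∧ y = stairPoint N A r c (j + 1) ∨
        y = stairPoint N A r c j ∧ x = stairPoint N A r c (j + 1)) := by
  have hNr : (0 : ℝ) < N := by exact_mod_cast hr.pos
  -- stairs between two given ones
  have hmid : ∀ c i j, i + 1 < j → toPlane (stairPoint N A r c (i + 1)) ∈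
      segment ℝ (toPlane (stairPoint N A r c i)) (toPlane (stairPoint N A r c j)) := by
    intro c i j hij
    have hd : (0 : ℝ) < (j : ℝ) - i := by
      have : ((i + 1 : ℕ) : ℝ) < j := by exact_mod_cast hij
      push_cast at this; linarith
    refine ⟨1 - 1 / ((j : ℝ) - i), 1 / ((j : ℝ) - i), ?_, by positivity, by ring, ?_⟩
    · rw [sub_nonneg, div_le_one hd]
      have : ((i + 1 : ℕ) : ℝ) ≤ j := by exact_mod_cast hij.le
      push_cast at this; linarith
    · simp only [toPlane, stairPoint]
      ext <;> simp <;> field_simp <;> ring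
  have hbetween : ∀ c i t, t ∈ stairs n m c → toPlane t ∈ segment ℝ
      (toPlane (stairPoint N A r c i)) (toPlane (stairPoint N A r c (i + 1))) →
      t = stairPoint N A r c i ∨ t = stairPoint N A r c (i + 1) := by
    intro c i t ht hseg
    obtain ⟨l, _, rfl⟩ := (h.mem_stairs_iff hr c t).mp ht
    obtain ⟨a, b, ha, hb, hab, he⟩ := hseg
    have h2 := congrArg Prod.snd he
    simp only [toPlane, stairPoint, Prod.snd_add, Prod.smul_snd, smul_eq_mul] at h2
    push_cast at h2
    have h3 : (N : ℝ) * (l - i - b) = 0 := by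
      have ha' : a = 1 - b := by linarith
      rw [ha'] at h2
      linarith
    have h4 := (mul_eq_zero.mp h3).resolve_left hNr.ne'
    have h5 : (i : ℝ) ≤ l := by linarith
    have h6 : (l : ℝ) ≤ (i + 1 : ℕ) := by push_cast; linarith
    rw [Nat.cast_le] at h5 h6
    rcases (by omega : l = i ∨ l = i + 1) with rfl | rfl <;> simp
  constructor
  · rintro ⟨hne, c, hx, hy, hall⟩
    obtain ⟨i, hi, rfl⟩ := (h.mem_stairs_iff hr c x).mp hx
    obtain ⟨j, hj, rfl⟩ := (h.mem_stairs_iff hr c y).mp hy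
    rcases lt_trichotomy i j with hij | rfl | hij
    · refine ⟨c, i, by omega, Or.inl ⟨rfl, ?_⟩⟩
      by_contra hn
      have hlt : i + 1 < j := lt_of_le_of_ne hij fun e => hn (by rw [e])
      rcases hall _ ((h.mem_stairs_iff hr c _).mpr ⟨i + 1, by omega, rfl⟩) (hmid c i j hlt)
        with e | e
      · have := (stairPoint_inj hr e).2; omega
      · have := (stairPoint_inj hr e).2; omega
    · exact absurd rfl hne
    · refine ⟨c, j, by omega, Or.inr ⟨rfl, ?_⟩⟩
      by_contra hn
      have hlt : j + 1 < i := lt_of_le_of_ne hij fun e => hn (by rw [e])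
      rcases hall _ ((h.mem_stairs_iff hr c _).mpr ⟨j + 1, by omega, rfl⟩)
        (by rw [segment_symm]; exact hmid c j i hlt) with e | e
      · have := (stairPoint_inj hr e).2; omega
      · have := (stairPoint_inj hr e).2; omega
  · rintro ⟨c, j, hj, ⟨rfl, rfl⟩ | ⟨rfl, rfl⟩⟩
    · refine ⟨fun e => ?_, c, (h.mem_stairs_iff hr c _).mpr ⟨j, by omega, rfl⟩,
        (h.mem_stairs_iff hr c _).mpr ⟨j + 1, hj, rfl⟩, hbetween c j⟩
      have := (stairPoint_inj hr e).2; omega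
    · refine ⟨fun e => ?_, c, (h.mem_stairs_iff hr c _).mpr ⟨j + 1, hj, rfl⟩,
        (h.mem_stairs_iff hr c _).mpr ⟨j, by omega, rfl⟩, fun t ht hseg => ?_⟩
      · have := (stairPoint_inj hr e).2; omega
      · rw [segment_symm] at hseg
        exact (hbetween c j t ht hseg).symm

theorem length_stairPoint_lt (h : SectorShape n m N A Q) (c j : ℕ) :
    length (stairPoint N A r c j) < length (stairPoint N A r c (j + 1)) := by
  unfold length
  apply Real.sqrt_lt_sqrt (by positivity)
  have hN : 0 < N := by have := h.two_le; omega
  have h1 : (stairPoint N A r c j).1 < (stairPoint N A r c (j + 1)).1 := by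
    have := h.pos
    simp only [stairPoint, mul_add]; omega
  have h2 : (stairPoint N A r c j).2 < (stairPoint N A r c (j + 1)).2 := by
    simp only [stairPoint, mul_add]; omega
  have h1' : ((stairPoint N A r c j).1 : ℝ) < (stairPoint N A r c (j + 1)).1 := by
    exact_mod_cast h1
  have h2' : ((stairPoint N A r c j).2 : ℝ) < (stairPoint N A r c (j + 1)).2 := by
    exact_mod_cast h2
  gcongr

end SectorShape

/-! ### Stair polynomials along staircases -/

theorem exists_eval_eq_of_quadraticPart {p q : MvPolynomial (Fin 2) ℝ} (hp : p.totalDegree = 2)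
    (hq : MvPolynomial.homogeneousComponent 2 p = q) :
    ∃ b₁ b₂ d : ℝ, ∀ x y, evalAt p x y = evalAt q x y + b₁ * x + b₂ * y + d := by
  have h1 : MvPolynomial.homogeneousComponent 1 p ∈
      Submodule.span ℝ (Set.range (MvPolynomial.X : Fin 2 → MvPolynomial (Fin 2) ℝ)) := by
    rw [← MvPolynomial.homogeneousSubmodule_one_eq_span_X]
    exact MvPolynomial.homogeneousComponent_mem 1 p
  obtain ⟨a, ha⟩ := (Submodule.mem_span_range_iff_exists_fun ℝ).mp h1
  refine ⟨a 0, a 1, MvPolynomial.coeff 0 p, fun x y => ?_⟩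
  have hs := MvPolynomial.sum_homogeneousComponent p
  rw [hp, Finset.sum_range_succ, Finset.sum_range_succ, Finset.sum_range_one, hq, ← ha,
    MvPolynomial.homogeneousComponent_zero, Fin.sum_univ_two] at hs
  unfold evalAt
  conv_lhs => rw [← hs]
  simp
  ring

theorem IsStair.exists_evalAt_eq {n m k : ℕ} {p : MvPolynomial (Fin 2) ℝ} (h : IsStair n m k p) :
    ∃ b₁ b₂ d : ℝ, ∀ x y, evalAt p x y =
      (n : ℝ) / 2 * (x - ((m : ℝ) - 1) / n * y) ^ 2 + b₁ * x + b₂ * y + d := by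
  obtain ⟨b₁, b₂, d, hf⟩ := exists_eval_eq_of_quadraticPart h.totalDegree_eq h.quadraticPart_eq
  refine ⟨b₁, b₂, d, fun x y => ?_⟩
  rw [hf]
  simp [evalAt]

/-- The second difference p(0,2) - 2p(0,1) + p(0,0) is (m-1)²/n. -/
theorem IsStair.dvd {n m k : ℕ} {p : MvPolynomial (Fin 2) ℝ} (hm : 0 < m) (hn : 0 < n)
    (h : IsStair n m k p) : n ∣ (m - 1) ^ 2 := by
  obtain ⟨b₁, b₂, d, hf⟩ := h.exists_evalAt_eq
  obtain ⟨w0, h0⟩ := h.integerValued 0 0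
  obtain ⟨w1, h1⟩ := h.integerValued 0 1
  obtain ⟨w2, h2⟩ := h.integerValued 0 2
  rw [hf] at h0 h1 h2
  push_cast at h0 h1 h2
  have hn' : (n : ℝ) ≠ 0 := by exact_mod_cast hn.ne'
  have e : ((m : ℝ) - 1) ^ 2 = n * (w2 - 2 * w1 + w0) := by
    rw [← h0, ← h1, ← h2]
    field_simp
    ring
  have e' : ((m : ℤ) - 1) ^ 2 = n * (w2 - 2 * w1 + w0) := by exact_mod_cast e
  have : (n : ℤ) ∣ ((m - 1 : ℕ) : ℤ) ^ 2 := by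
    rw [Nat.cast_sub hm]
    exact ⟨_, by exact_mod_cast e'⟩
  exact_mod_cast this

/-- A packing polynomial enumerates `ℕ` bijectively along the staircases. -/
theorem SectorShape.isPacking_iff {n m N A Q : ℕ} {r : ℕ → ℕ} (h : SectorShape n m N A Q)
    (hr : ResidueSystem N A r) (p : MvPolynomial (Fin 2) ℝ) (w : ℕ → ℕ → ℤ)
    (hw : ∀ c j, value p (stairPoint N A r c j) = w c j) :
    IsPacking (sector ((n : ℝ) / m)) p ↔
      (∀ c j, j < stairCount N Q c → 0 ≤ w c j) ∧
      (∀ v : ℕ, ∃ c j, j < stairCount N Q c ∧ w c j = v) ∧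
      (∀ c j c' j', j < stairCount N Q c → j' < stairCount N Q c' → w c j = w c' j' →
        c = c' ∧ j = j') := by
  have hmem := h.mem_sector_iff hr
  constructor
  · rintro ⟨hmap, hinj, hsurj⟩
    refine ⟨fun c j hj => ?_, fun v => ?_, fun c j c' j' hj hj' e => ?_⟩
    · obtain ⟨v, hv⟩ := hmap ((hmem _).mpr ⟨c, j, hj, rfl⟩)
      rw [hw] at hv
      have : (v : ℤ) = w c j := by exact_mod_cast hv
      omega
    · obtain ⟨z, hz, hv⟩ := hsurj ⟨v, rfl⟩
      obtain ⟨c, j, hj, rfl⟩ := (hmem z).mp hz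
      rw [hw] at hv
      exact ⟨c, j, hj, by exact_mod_cast hv⟩
    · exact SectorShape.stairPoint_inj hr
        (hinj ((hmem _).mpr ⟨c, j, hj, rfl⟩) ((hmem _).mpr ⟨c', j', hj', rfl⟩) (by rw [hw, hw, e]))
  · rintro ⟨hnn, hsurj, hinj⟩
    refine ⟨fun z hz => ?_, fun z hz z' hz' e => ?_, ?_⟩
    · obtain ⟨c, j, hj, rfl⟩ := (hmem z).mp hz
      refine ⟨(w c j).toNat, ?_⟩
      rw [hw]
      exact_mod_cast congrArg (Int.cast (R := ℝ)) (Int.toNat_of_nonneg (hnn c j hj))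
    · obtain ⟨c, j, hj, rfl⟩ := (hmem z).mp hz
      obtain ⟨c', j', hj', rfl⟩ := (hmem z').mp hz'
      rw [hw, hw] at e
      obtain ⟨rfl, rfl⟩ := hinj c j c' j' hj hj' (by exact_mod_cast e)
      rfl
    · rintro _ ⟨v, rfl⟩
      obtain ⟨c, j, hj, hv⟩ := hsurj v
      exact ⟨_, (hmem _).mpr ⟨c, j, hj, rfl⟩, by rw [hw, hv]; simp⟩

theorem SectorShape.value_stairPoint {n m N A Q k : ℕ} {r : ℕ → ℕ} {p : MvPolynomial (Fin 2) ℝ}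
    (h : SectorShape n m N A Q) (hr : ResidueSystem N A r) (hp : IsStair n m k p) :
    ∃ β γ δ : ℝ, ∀ c j, value p (stairPoint N A r c j) =
      (Q : ℝ) / 2 * c ^ 2 + β * c + γ * (r c + N * j) + δ := by
  obtain ⟨b₁, b₂, d, hf⟩ := hp.exists_evalAt_eq
  have hN : (N : ℝ) ≠ 0 := by exact_mod_cast hr.pos.ne'
  have hQ : (Q : ℝ) ≠ 0 := by exact_mod_cast h.mult_pos.ne'
  refine ⟨b₁ / N, b₂ + b₁ * A / N, d, fun c j => ?_⟩
  have hs : (N : ℝ) * (stairPoint N A r c j).1 = c + A * (stairPoint N A r c j).2 := by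
    exact_mod_cast stairPoint_spec hr c j
  have hy : ((stairPoint N A r c j).2 : ℝ) = r c + N * j := by
    simp [stairPoint]
  rw [value, hf, ← hy, h.num_eq, h.den_eq]
  have hx : ((stairPoint N A r c j).1 : ℝ) = (c + A * (stairPoint N A r c j).2) / N := by
    rw [← hs]; field_simp
  rw [hx]
  push_cast
  field_simp
  ring

/-- Supplies a consecutive pair in every sector; the slope γ, common to all staircases, is read off
from it. -/
theorem SectorShape.two_stairs {n m N A Q : ℕ} (h : SectorShape n m N A Q) :
    0 + 1 < stairCount N Q N := by
  have := Nat.mul_pos h.mult_pos (show 0 < N by have := h.two_le; omega)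
  rw [stairCount, if_pos dvd_rfl]
  omega

theorem exists_tiling_of_ascending {n m N A Q k : ℕ} {p : MvPolynomial (Fin 2) ℝ} {r : ℕ → ℕ}
    (h : SectorShape n m N A Q) (hr : ResidueSystem N A r) {β γ δ : ℝ}
    (hf : ∀ c j, value p (stairPoint N A r c j) =
      (Q : ℝ) / 2 * c ^ 2 + β * c + γ * (r c + N * j) + δ)
    (hγ : γ * N = k) (hint : ∀ x y : ℤ, ∃ w : ℤ, evalAt p x y = w)
    (hpack : IsPacking (sector ((n : ℝ) / m)) p) :
    ∃ b : ℕ → ℤ, (∀ c : ℕ, (b c : ℝ) = (Q : ℝ) / 2 * c ^ 2 + β * c + k * r c / N + δ) ∧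
      ProgressionTiling k b (stairCount N Q) := by
  have hN : (N : ℝ) ≠ 0 := by exact_mod_cast hr.pos.ne'
  have hb : ∀ c, ∃ w : ℤ, value p (stairPoint N A r c 0) = w := fun c => by
    obtain ⟨w, hw⟩ := hint (stairPoint N A r c 0).1 (stairPoint N A r c 0).2
    exact ⟨w, by simpa [value] using hw⟩
  choose b hb using hb
  have hbf : ∀ c : ℕ, (b c : ℝ) = (Q : ℝ) / 2 * c ^ 2 + β * c + k * r c / N + δ := fun c => by
    rw [← hb, hf, ← hγ]
    field_simp
    push_cast
    ring
  obtain ⟨h1, h2, h3⟩ := (h.isPacking_iff hr p (fun c j => b c + k * j) (fun c j => by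
    push_cast
    rw [← hb, hf, hf, ← hγ]
    push_cast
    ring)).mp hpack
  exact ⟨b, hbf, h1, h2, h3⟩

/-- Reversing each progression makes it ascending: its start becomes the old last value, which
shifts β by -kQ and replaces r c by N - r c (or keeps 0). -/
theorem exists_tiling_of_descending {n m N A Q k : ℕ} {p : MvPolynomial (Fin 2) ℝ} {r : ℕ → ℕ}
    (h : SectorShape n m N A Q) (hr : ResidueSystem N A r) {β γ δ : ℝ}
    (hf : ∀ c j, value p (stairPoint N A r c j) =
      (Q : ℝ) / 2 * c ^ 2 + β * c + γ * (r c + N * j) + δ)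
    (hγ : γ * N = -(k : ℝ)) (hint : ∀ x y : ℤ, ∃ w : ℤ, evalAt p x y = w)
    (hpack : IsPacking (sector ((n : ℝ) / m)) p) :
    ∃ b : ℕ → ℤ, (∀ c : ℕ, (b c : ℝ) = (Q : ℝ) / 2 * c ^ 2 + (β - k * Q) * c +
        k * ((if N ∣ c then 0 else N - r c : ℕ) : ℝ) / N + δ) ∧
      ProgressionTiling k b (stairCount N Q) := by
  have hN : (N : ℝ) ≠ 0 := by exact_mod_cast hr.pos.ne'
  have hb : ∀ c, ∃ w : ℤ, value p (stairPoint N A r c 0) = w := fun c => by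
    obtain ⟨w, hw⟩ := hint (stairPoint N A r c 0).1 (stairPoint N A r c 0).2
    exact ⟨w, by simpa [value] using hw⟩
  choose b hb using hb
  have hγ' : (k : ℝ) = -(γ * N) := by linarith
  obtain ⟨h1, h2, h3⟩ := (h.isPacking_iff hr p (fun c j => b c - k * j) (fun c j => by
    push_cast
    rw [← hb, hf, hf, hγ']
    push_cast
    ring)).mp hpack
  refine ⟨fun c => b c - k * (stairCount N Q c - 1), fun c => ?_, fun c j hj => ?_, fun v => ?_,
    fun c j c' j' hj hj' e => ?_⟩
  · push_cast
    rw [← hb, hf, hγ', stairCount]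
    split_ifs with hc
    · have := (hr.eq_zero_iff c).mpr hc
      rw [this]
      push_cast
      field_simp
      ring
    · rw [Nat.cast_sub (hr.lt c).le]
      push_cast
      field_simp
      ring
  · have := h1 c (stairCount N Q c - 1 - j) (by omega)
    rw [Nat.sub_sub, Nat.cast_sub (by omega)] at this
    push_cast at this
    linarith
  · obtain ⟨c, j, hj, hv⟩ := h2 v
    refine ⟨c, stairCount N Q c - 1 - j, by omega, ?_⟩
    rw [Nat.sub_sub, Nat.cast_sub (by omega), ← hv]
    push_cast
    ring
  · have := h3 c (stairCount N Q c - (1 + j)) c' (stairCount N Q c' - (1 + j')) (by omega)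
      (by omega) (by
        rw [Nat.cast_sub (by omega), Nat.cast_sub (by omega)]
        push_cast
        linarith)
    obtain ⟨rfl, h4⟩ := this
    exact ⟨rfl, by omega⟩

/-! ### The first k starts for k = 2, 3, 4 -/

theorem exists_offset {N Q k : ℕ} {A : ℤ} {r : ℕ → ℕ} {b : ℕ → ℤ} {δ : ℤ}
    (hr : ResidueSystem N A r) (hdvd : (N : ℤ) ∣ k - A)
    (hb : ∀ c : ℕ, N * (2 * b c) = (N : ℤ) * Q * c * (c - k) + 2 * (c + k * r c) + N * (2 * δ))
    (c : ℕ) (hc : 0 < c) (hck : c < k) : ∃ t : ℤ, 0 < t ∧ t < k ∧ c + k * r c = N * t ∧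
      2 * b c = Q * c * (c - k) + 2 * t + 2 * δ := by
  have hNz : (0 : ℤ) < N := by exact_mod_cast hr.pos
  -- Modulo N the coefficient k may be replaced by A, which defines r.
  obtain ⟨t, ht⟩ : (N : ℤ) ∣ c + k * r c := by
    rw [show (c : ℤ) + k * r c = (c + A * r c) + (k - A) * r c by ring]
    exact dvd_add (hr.dvd c) (Dvd.dvd.mul_right hdvd _)
  have hcz : (0 : ℤ) < c := by exact_mod_cast hc
  have hckz : (c : ℤ) < k := by exact_mod_cast hck
  have hrz : (r c : ℤ) + 1 ≤ N := by exact_mod_cast hr.lt c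
  have hr0 : (0 : ℤ) ≤ k * r c := by positivity
  refine ⟨t, ?_, ?_, ht, ?_⟩
  · exact pos_of_mul_pos_right (ht ▸ by linarith) hNz.le
  · have h2 : (k : ℤ) * (r c + 1) ≤ k * N := mul_le_mul_of_nonneg_left hrz (by positivity)
    exact lt_of_mul_lt_mul_left (a := (N : ℤ)) (by linarith) hNz.le
  · have := hb c
    rw [ht] at this
    exact mul_left_cancel₀ hNz.ne' (by linarith)

/-- The consequences of `ProgressionTiling.rigidity` for the first `k` progressions. -/
theorem ProgressionTiling.initial {N Q k : ℕ} {A : ℤ} {r : ℕ → ℕ} {b : ℕ → ℤ} {β δ : ℝ}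
    (hN : 2 ≤ N) (hQ : 0 < Q) (hr : ResidueSystem N A r)
    (hb : ∀ c : ℕ, (b c : ℝ) = (Q : ℝ) / 2 * c ^ 2 + β * c + k * r c / N + δ)
    (h : ProgressionTiling k b (stairCount N Q)) :
    (N : ℤ) ∣ k - A ∧
      (∀ c, 0 < c → c < k → ∃ t : ℤ, 0 < t ∧ t < k ∧ c + k * r c = N * t ∧
        2 * b c = Q * c * (c - k) + 2 * t + 2 * b 0) ∧
      ∀ v < k, ∃ c < k, b c = v := by
  obtain ⟨hdvd, hform⟩ := h.rigidity hN hQ hr hb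
  exact ⟨hdvd, exists_offset hr hdvd hform, fun v hv =>
    h.exists_first (stairCount_pos hQ) (next_of_formula hr hdvd hform) hv⟩

section Cases

variable {N Q : ℕ} {A : ℤ} {r : ℕ → ℕ} {b : ℕ → ℤ} {β δ : ℝ}

theorem ProgressionTiling.mult_eq_four (hN : 2 ≤ N) (hQ : 0 < Q) (hr : ResidueSystem N A r)
    (hb : ∀ c : ℕ, (b c : ℝ) = (Q : ℝ) / 2 * c ^ 2 + β * c + (2 : ℕ) * r c / N + δ)
    (h : ProgressionTiling 2 b (stairCount N Q)) : Q = 4 := by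
  obtain ⟨-, ht, hv⟩ := h.initial hN hQ hr hb
  obtain ⟨t, h1, h2, -, h3⟩ := ht 1 (by omega) (by omega)
  obtain ⟨c, hc, h4⟩ := hv 0 (by omega)
  obtain ⟨d, hd, h5⟩ := hv 1 (by omega)
  push_cast at h3
  interval_cases c <;> interval_cases d <;> omega

theorem ProgressionTiling.mult_eq_three (hN : 2 ≤ N) (hQ : 0 < Q) (hr : ResidueSystem N A r)
    (hb : ∀ c : ℕ, (b c : ℝ) = (Q : ℝ) / 2 * c ^ 2 + β * c + (3 : ℕ) * r c / N + δ)
    (h : ProgressionTiling 3 b (stairCount N Q)) : Q = 3 := by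
  obtain ⟨-, ht, hv⟩ := h.initial hN hQ hr hb
  obtain ⟨t, h1, h2, h3, h4⟩ := ht 1 (by omega) (by omega)
  obtain ⟨s, h1', h2', h3', h4'⟩ := ht 2 (by omega) (by omega)
  -- Equal offsets would give 1 + 3 r 1 = 2 + 3 r 2.
  have hne : t ≠ s := by
    rintro rfl
    omega
  obtain ⟨c, hc, e0⟩ := hv 0 (by omega)
  obtain ⟨d, hd, e1⟩ := hv 1 (by omega)
  obtain ⟨e, he, e2⟩ := hv 2 (by omega)
  push_cast at h4 h4'
  interval_cases c <;> interval_cases d <;> interval_cases e <;> omega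

/-- For q = 1 the four numbers take only two values; for q ≥ 2 the number x exceeds each of the
others by at least 3, so they cannot fill 0, …, 3. -/
theorem not_four_values {q : ℤ} (hq : 0 < q) (x : ℤ)
    (h0 : x = 0 ∨ x - 3 * q + 1 = 0 ∨ x - 3 * q + 3 = 0 ∨ x - 4 * q + 2 = 0)
    (h1 : x = 1 ∨ x - 3 * q + 1 = 1 ∨ x - 3 * q + 3 = 1 ∨ x - 4 * q + 2 = 1)
    (h2 : x = 2 ∨ x - 3 * q + 1 = 2 ∨ x - 3 * q + 3 = 2 ∨ x - 4 * q + 2 = 2)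
    (h3 : x = 3 ∨ x - 3 * q + 1 = 3 ∨ x - 3 * q + 3 = 3 ∨ x - 4 * q + 2 = 3) : False := by
  rcases (by omega : q = 1 ∨ 2 ≤ q) with rfl | hq2
  · omega
  by_cases hx : x ≤ 3
  · have : x = 3 := by omega
    omega
  · have h0' := h0.resolve_left (by omega)
    have h1' := h1.resolve_left (by omega)
    have h2' := h2.resolve_left (by omega)
    have h3' := h3.resolve_left (by omega)
    omega

theorem ProgressionTiling.not_four (hN : 2 ≤ N) (hQ : 0 < Q) (hr : ResidueSystem N A r)
    (hb : ∀ c : ℕ, (b c : ℝ) = (Q : ℝ) / 2 * c ^ 2 + β * c + (4 : ℕ) * r c / N + δ)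
    (h : ProgressionTiling 4 b (stairCount N Q)) : False := by
  obtain ⟨hA, ht, hv⟩ := h.initial hN hQ hr hb
  have hodd : ¬ (2 : ℤ) ∣ N := by
    intro h2
    have h3 : (2 : ℤ) ∣ A := by have := dvd_trans h2 hA; omega
    have := hr.coprime.isUnit_of_dvd' h2 h3
    rw [Int.isUnit_iff] at this
    omega
  obtain ⟨t, h1, h2, h3, h4⟩ := ht 1 (by omega) (by omega)
  obtain ⟨s, h1', h2', h3', h4'⟩ := ht 2 (by omega) (by omega)
  obtain ⟨u, h1'', h2'', h3'', h4''⟩ := ht 3 (by omega) (by omega)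
  have hne : t ≠ u := by
    rintro rfl
    omega
  push_cast at h3 h3' h3'' h4 h4' h4'' h2 h2' h2''
  -- N is odd and Ns = 2 + 4 r 2, so s is even.
  have hs : s = 2 := by interval_cases s <;> omega
  have ht2 : t ≠ 2 := by rintro rfl; omega
  have hu2 : u ≠ 2 := by rintro rfl; omega
  obtain ⟨q, hq⟩ : ∃ q : ℤ, (Q : ℤ) = 2 * q := ⟨Q / 2, by omega⟩
  have hval : ∀ v < 4, b 0 = (v : ℕ) ∨ b 0 - 3 * q + 1 = v ∨ b 0 - 3 * q + 3 = v ∨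
      b 0 - 4 * q + 2 = v := by
    intro v hv4
    obtain ⟨c, hc, e⟩ := hv v hv4
    interval_cases c <;> omega
  exact not_four_values (q := q) (by omega) (b 0) (by simpa using hval 0 (by omega))
    (by simpa using hval 1 (by omega)) (by simpa using hval 2 (by omega))
    (by simpa using hval 3 (by omega))

end Cases

/-! ### Construction of ascending stair polynomials -/

open MvPolynomial in
/-- The ascending `k`-stair polynomial with constant term `δ` on a sector of shape `N, A, Q`. -/
noncomputable def stairPoly (n m N A Q k : ℕ) (δ : ℤ) : MvPolynomial (Fin 2) ℝ :=
  C ((n : ℝ) / 2) * (X 0 - C (((m : ℝ) - 1) / n) * X 1) ^ 2 +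
    (C (1 - (Q : ℝ) * N * k / 2) * X 0 + C (((k : ℝ) - A) / N + (Q : ℝ) * A * k / 2) * X 1) +
    C (δ : ℝ)

section StairPoly

variable {n m N A Q k : ℕ} {δ : ℤ} {r : ℕ → ℕ}

/-- With c = Nx - Ay the value is Qc(c-k)/2 + (c + ky)/N + δ, the form dictated by rigidity. -/
theorem SectorShape.evalAt_stairPoly (h : SectorShape n m N A Q) (x y : ℝ) :
    evalAt (stairPoly n m N A Q k δ) x y =
      (Q : ℝ) / 2 * (N * x - A * y) * (N * x - A * y - k) + x + (k - A) / N * y + δ := by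
  have hN : (N : ℝ) ≠ 0 := by have := h.two_le; exact_mod_cast (by omega : N ≠ 0)
  have hQ : (Q : ℝ) ≠ 0 := by exact_mod_cast h.mult_pos.ne'
  simp [evalAt, stairPoly]
  rw [h.num_eq, h.den_eq]
  push_cast
  field_simp
  ring

theorem SectorShape.integral_stairPoly (h : SectorShape n m N A Q) (hdvd : (N : ℤ) ∣ k - A)
    (h1 : (2 : ℤ) ∣ Q * N * (N - k)) (h2 : (2 : ℤ) ∣ Q * A * (A + k)) (x y : ℤ) :
    ∃ w : ℤ, evalAt (stairPoly n m N A Q k δ) x y = w := by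
  have hN : (N : ℝ) ≠ 0 := by have := h.two_le; exact_mod_cast (by omega : N ≠ 0)
  obtain ⟨e, he⟩ := hdvd
  have he' : (k : ℝ) - A = N * e := by exact_mod_cast he
  -- Since x² ≡ x and y² ≡ y modulo 2, only the parities at (1,0) and (0,1) matter; these are `h1`
  -- and `h2`.
  obtain ⟨f, hf⟩ : (2 : ℤ) ∣ Q * (N * x - A * y) * (N * x - A * y - k) := by
    have hx : (2 : ℤ) ∣ x * (x - 1) := (Int.even_mul_pred_self x).two_dvd
    have hy : (2 : ℤ) ∣ y * (y - 1) := (Int.even_mul_pred_self y).two_dvd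
    rw [show (Q : ℤ) * (N * x - A * y) * (N * x - A * y - k) =
      (Q * N * (N - k)) * x + (Q * A * (A + k)) * y + (x * (x - 1)) * (Q * N ^ 2) +
        (y * (y - 1)) * (Q * A ^ 2) + 2 * (-Q * N * A * x * y) by ring]
    exact dvd_add (dvd_add (dvd_add (dvd_add (h1.mul_right _) (h2.mul_right _)) (hx.mul_right _))
      (hy.mul_right _)) (Dvd.intro _ rfl)
  refine ⟨f + x + e * y + δ, ?_⟩
  have hf' : (Q : ℝ) * (N * x - A * y) * (N * x - A * y - k) = 2 * f := by exact_mod_cast hf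
  rw [h.evalAt_stairPoly, he']
  push_cast
  field_simp
  linear_combination hf'

theorem SectorShape.value_stairPoly (h : SectorShape n m N A Q) (hr : ResidueSystem N A r)
    (c j : ℕ) : value (stairPoly n m N A Q k δ) (stairPoint N A r c j) =
      (Q : ℝ) / 2 * c ^ 2 + (1 / N - Q * k / 2) * c + (k / N) * (r c + N * j) + δ := by
  have hN : (N : ℝ) ≠ 0 := by exact_mod_cast hr.pos.ne'
  have hs : (N : ℝ) * (stairPoint N A r c j).1 = c + A * (stairPoint N A r c j).2 := by
    exact_mod_cast stairPoint_spec hr c j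
  have hy : ((stairPoint N A r c j).2 : ℝ) = r c + N * j := by
    simp [stairPoint]
  rw [value, h.evalAt_stairPoly, ← hy]
  have hx : ((stairPoint N A r c j).1 : ℝ) = (c + A * (stairPoint N A r c j).2) / N := by
    rw [← hs]; field_simp
  rw [hx]
  field_simp
  ring

open MvPolynomial in
theorem homogeneousComponent_stairPoly : homogeneousComponent 2 (stairPoly n m N A Q k δ) =
    C ((n : ℝ) / 2) * (X 0 - C (((m : ℝ) - 1) / n) * X 1) ^ 2 := by
  have h2 : (C ((n : ℝ) / 2) * (X 0 - C (((m : ℝ) - 1) / n) * X 1) ^ 2 :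
      MvPolynomial (Fin 2) ℝ) ∈ homogeneousSubmodule (Fin 2) ℝ 2 :=
    (((isHomogeneous_X _ _).sub (isHomogeneous_C_mul_X _ _)).pow 2).C_mul _
  have h1 : (C (1 - (Q : ℝ) * N * k / 2) * X 0 + C (((k : ℝ) - A) / N + (Q : ℝ) * A * k / 2) * X 1 :
      MvPolynomial (Fin 2) ℝ) ∈ homogeneousSubmodule (Fin 2) ℝ 1 :=
    (isHomogeneous_C_mul_X _ _).add (isHomogeneous_C_mul_X _ _)
  have h0 : (C (δ : ℝ) : MvPolynomial (Fin 2) ℝ) ∈ homogeneousSubmodule (Fin 2) ℝ 0 :=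
    isHomogeneous_C _ _
  rw [stairPoly, map_add, map_add, homogeneousComponent_of_mem h2, homogeneousComponent_of_mem h1,
    homogeneousComponent_of_mem h0]
  simp

open MvPolynomial in
theorem totalDegree_stairPoly (hn : 0 < n) : (stairPoly n m N A Q k δ).totalDegree = 2 := by
  apply le_antisymm
  · have h2 : (C ((n : ℝ) / 2) * (X 0 - C (((m : ℝ) - 1) / n) * X 1) ^ 2 :
        MvPolynomial (Fin 2) ℝ).totalDegree ≤ 2 :=
      ((((isHomogeneous_X _ _).sub (isHomogeneous_C_mul_X _ _)).pow 2).C_mul _).totalDegree_le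
    have h1 : (C (1 - (Q : ℝ) * N * k / 2) * X 0 +
        C (((k : ℝ) - A) / N + (Q : ℝ) * A * k / 2) * X 1 :
        MvPolynomial (Fin 2) ℝ).totalDegree ≤ 1 :=
      ((isHomogeneous_C_mul_X _ _).add (isHomogeneous_C_mul_X _ _)).totalDegree_le
    unfold stairPoly
    refine (totalDegree_add _ _).trans (max_le ((totalDegree_add _ _).trans
      (max_le h2 (h1.trans (by norm_num)))) ?_)
    exact (totalDegree_C _).le.trans (by norm_num)
  · by_contra hlt
    have h := homogeneousComponent_eq_zero 2 (stairPoly n m N A Q k δ) (not_le.mp hlt)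
    rw [homogeneousComponent_stairPoly] at h
    have := congrArg (MvPolynomial.eval ![(1 : ℝ), 0]) h
    simp at this
    omega

theorem SectorShape.isAscendingStair_stairPoly (h : SectorShape n m N A Q)
    (hdvd : (N : ℤ) ∣ k - A) (h1 : (2 : ℤ) ∣ Q * N * (N - k)) (h2 : (2 : ℤ) ∣ Q * A * (A + k)) :
    IsAscendingStair n m k (stairPoly n m N A Q k δ) := by
  have hNpos : 0 < N := by have := h.two_le; omega
  have hNr : (N : ℝ) ≠ 0 := by exact_mod_cast hNpos.ne'
  obtain ⟨r, hr⟩ := ResidueSystem.exists hNpos (Nat.isCoprime_iff_coprime.mpr h.coprime)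
  have hdiff : ∀ c j, value (stairPoly n m N A Q k δ) (stairPoint N A r c (j + 1)) -
      value (stairPoly n m N A Q k δ) (stairPoint N A r c j) = k := by
    intro c j
    rw [h.value_stairPoly hr, h.value_stairPoly hr]
    push_cast
    field_simp
    ring
  refine ⟨⟨totalDegree_stairPoly ?_, homogeneousComponent_stairPoly,
    h.integral_stairPoly hdvd h1 h2, fun x y hxy => ?_⟩, fun x y hxy hlt => ?_⟩
  · rw [h.num_eq]
    exact Nat.mul_pos (by positivity) h.mult_pos
  · obtain ⟨c, j, -, ⟨rfl, rfl⟩ | ⟨rfl, rfl⟩⟩ := (h.consecutive_iff hr x y).mp hxy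
    · right; linarith [hdiff c j]
    · left; exact hdiff c j
  · obtain ⟨c, j, -, ⟨rfl, rfl⟩ | ⟨rfl, rfl⟩⟩ := (h.consecutive_iff hr x y).mp hxy
    · exact hdiff c j
    · exact absurd hlt (h.length_stairPoint_lt c j).not_gt

theorem SectorShape.isPacking_stairPoly (h : SectorShape n m N A Q) (hr : ResidueSystem N A r)
    (hk : 0 < k) (hdvd : (N : ℤ) ∣ k - A) (h1 : (2 : ℤ) ∣ Q * N * (N - k))
    (h2 : (2 : ℤ) ∣ Q * A * (A + k))
    (hinit : ∀ b : ℕ → ℤ, b 0 = δ → (∀ c, 0 < c → c < k → ∃ t : ℤ, 0 < t ∧ t < k ∧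
        c + k * r c = N * t ∧ 2 * b c = Q * c * (c - k) + 2 * t + 2 * δ) →
      (∀ c < k, 0 ≤ b c ∧ b c < k) ∧ ∀ c < k, ∀ c' < k, b c = b c' → c = c') :
    IsPacking (sector ((n : ℝ) / m)) (stairPoly n m N A Q k δ) := by
  have hNr : (N : ℝ) ≠ 0 := by exact_mod_cast hr.pos.ne'
  have hb : ∀ c, ∃ w : ℤ, value (stairPoly n m N A Q k δ) (stairPoint N A r c 0) = w := fun c => by
    obtain ⟨w, hw⟩ := h.integral_stairPoly (δ := δ) hdvd h1 h2
      (stairPoint N A r c 0).1 (stairPoint N A r c 0).2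
    exact ⟨w, by simpa [value] using hw⟩
  choose b hb using hb
  have hform : ∀ c : ℕ,
      N * (2 * b c) = (N : ℤ) * Q * c * (c - k) + 2 * (c + k * r c) + N * (2 * δ) := by
    intro c
    have : (N : ℝ) * (2 * b c) = (N : ℝ) * Q * c * (c - k) + 2 * (c + k * r c) + N * (2 * δ) := by
      rw [← hb, h.value_stairPoly hr]
      push_cast
      field_simp
      ring
    exact_mod_cast this
  obtain ⟨hm, hi⟩ := hinit b (by
    have := hform 0
    rw [(hr.eq_zero_iff 0).mpr (dvd_zero _)] at this
    simp at this
    exact this.resolve_right hr.pos.ne') (exists_offset hr hdvd hform)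
  have ht := ProgressionTiling.of_next hk (stairCount_pos h.mult_pos)
    (next_of_formula hr hdvd hform) hm hi
  refine (h.isPacking_iff hr _ (fun c j => b c + k * j) (fun c j => ?_)).mpr
    ⟨ht.nonneg, ht.surj, ht.inj⟩
  push_cast
  rw [← hb, h.value_stairPoly hr, h.value_stairPoly hr]
  push_cast
  field_simp
  ring

end StairPoly

/-! ### Classification for each k -/

theorem eq_of_dvd_sub {N A k : ℕ} (hA : A < N) (hk : k < N) (h : (N : ℤ) ∣ k - A) : A = k := by
  have := Int.eq_zero_of_abs_lt_dvd h (by rw [abs_lt]; omega)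
  omega

/-- An ascending stair packing polynomial yields the shape of the sector and a tiling. -/
theorem exists_shape_and_tiling {n m k : ℕ} (hm : 2 ≤ m) (hmn : m < n)
    {p : MvPolynomial (Fin 2) ℝ} (hpack : IsPacking (sector ((n : ℝ) / m)) p)
    (hp : IsAscendingStair n m k p) :
    ∃ (N A Q : ℕ) (r : ℕ → ℕ) (b : ℕ → ℤ) (β δ : ℝ), SectorShape n m N A Q ∧
      ResidueSystem N A r ∧
      (∀ c : ℕ, (b c : ℝ) = (Q : ℝ) / 2 * c ^ 2 + β * c + k * r c / N + δ) ∧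
      ProgressionTiling k b (stairCount N Q) := by
  obtain ⟨N, A, Q, h⟩ := SectorShape.exists hm hmn (hp.1.dvd (by omega) (by omega))
  obtain ⟨r, hr⟩ := ResidueSystem.exists (by have := h.two_le; omega)
    (Nat.isCoprime_iff_coprime.mpr h.coprime)
  obtain ⟨β, γ, δ, hf⟩ := h.value_stairPoint hr hp.1
  have hγ := hp.2 _ _ ((h.consecutive_iff hr _ _).mpr ⟨N, 0, h.two_stairs, Or.inl ⟨rfl, rfl⟩⟩)
    (h.length_stairPoint_lt N 0)
  rw [hf, hf] at hγ
  push_cast at hγ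
  obtain ⟨b, hb, ht⟩ := exists_tiling_of_ascending h hr hf (by linarith) hp.1.integerValued hpack
  exact ⟨N, A, Q, r, b, β, δ, h, hr, hb, ht⟩

theorem not_packing_four {n m : ℕ} (hm : 2 ≤ m) (hmn : m < n)
    {p : MvPolynomial (Fin 2) ℝ} (hpack : IsPacking (sector ((n : ℝ) / m)) p)
    (hp : IsStair n m 4 p) : False := by
  obtain ⟨N, A, Q, h⟩ := SectorShape.exists hm hmn (hp.dvd (by omega) (by omega))
  obtain ⟨r, hr⟩ := ResidueSystem.exists (by have := h.two_le; omega)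
    (Nat.isCoprime_iff_coprime.mpr h.coprime)
  obtain ⟨β, γ, δ, hf⟩ := h.value_stairPoint hr hp
  have hγ := hp.step _ _ ((h.consecutive_iff hr _ _).mpr ⟨N, 0, h.two_stairs, Or.inr ⟨rfl, rfl⟩⟩)
  rw [hf, hf] at hγ
  -- The sign at this one pair fixes γ, hence the direction on all staircases.
  rcases hγ with hγ | hγ
  · obtain ⟨b, hb, ht⟩ := exists_tiling_of_ascending h hr (k := 4) hf
      (by push_cast at hγ ⊢; linarith) hp.integerValued hpack
    exact ht.not_four h.two_le h.mult_pos hr hb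
  · obtain ⟨b, hb, ht⟩ := exists_tiling_of_descending h hr (k := 4) hf
      (by push_cast at hγ ⊢; linarith) hp.integerValued hpack
    exact ht.not_four h.two_le h.mult_pos hr.neg hb

namespace SectorShape

variable {n m N A Q : ℕ}

theorem exists_packing (h : SectorShape n m N A Q) {k : ℕ} (δ : ℤ) (hk : 0 < k)
    (hdvd : (N : ℤ) ∣ k - A) (h1 : (2 : ℤ) ∣ Q * N * (N - k)) (h2 : (2 : ℤ) ∣ Q * A * (A + k))
    (hinit : ∀ (r : ℕ → ℕ) (b : ℕ → ℤ), b 0 = δ → (∀ c, 0 < c → c < k → ∃ t : ℤ, 0 < t ∧ t < k ∧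
        c + k * r c = N * t ∧ 2 * b c = Q * c * (c - k) + 2 * t + 2 * δ) →
      (∀ c < k, 0 ≤ b c ∧ b c < k) ∧ ∀ c < k, ∀ c' < k, b c = b c' → c = c') :
    ∃ p, IsPacking (sector ((n : ℝ) / m)) p ∧ IsAscendingStair n m k p := by
  obtain ⟨r, hr⟩ := ResidueSystem.exists (by have := h.two_le; omega)
    (Nat.isCoprime_iff_coprime.mpr h.coprime)
  exact ⟨stairPoly n m N A Q k δ, h.isPacking_stairPoly hr hk hdvd h1 h2 (hinit r),
    h.isAscendingStair_stairPoly hdvd h1 h2⟩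

theorem exists_packing_one (h : SectorShape n m N 1 Q) :
    ∃ p, IsPacking (sector ((n : ℝ) / m)) p ∧ IsAscendingStair n m 1 p := by
  refine h.exists_packing 0 (by norm_num) (by simp) ?_ ?_ fun r b h0 _ => ?_
  · have : (2 : ℤ) ∣ N * (N - 1) := (Int.even_mul_pred_self _).two_dvd
    push_cast
    rw [mul_assoc]
    exact this.mul_left _
  · exact ⟨Q, by push_cast; ring⟩
  · constructor
    · intro c hc
      interval_cases c
      simp [h0]
    · intro c hc c' hc' _
      omega

theorem exists_packing_two (h : SectorShape n m N 2 4) :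
    ∃ p, IsPacking (sector ((n : ℝ) / m)) p ∧ IsAscendingStair n m 2 p := by
  refine h.exists_packing 1 (by norm_num) (by simp) ?_ (by norm_num) fun r b h0 ht => ?_
  · exact ⟨2 * N * (N - 2), by push_cast; ring⟩
  · obtain ⟨t, h1, h2, -, h3⟩ := ht 1 (by omega) (by omega)
    push_cast at h2 h3
    have hb1 : b 1 = 0 := by omega
    constructor
    · intro c hc
      interval_cases c <;> simp [h0, hb1]
    · intro c hc c' hc' e
      interval_cases c <;> interval_cases c' <;> omega

theorem exists_packing_three (h : SectorShape n m N A 3) (hdvd : (N : ℤ) ∣ 3 - A)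
    (h2 : (2 : ℤ) ∣ 3 * A * (A + 3)) :
    ∃ p, IsPacking (sector ((n : ℝ) / m)) p ∧ IsAscendingStair n m 3 p := by
  refine h.exists_packing 2 (by norm_num) hdvd ?_ h2 fun r b h0 ht => ?_
  · have : (2 : ℤ) ∣ N * (N - 1) := (Int.even_mul_pred_self _).two_dvd
    push_cast
    rw [show (3 : ℤ) * N * (N - 3) = 3 * (N * (N - 1)) + 2 * (-3 * N) by ring]
    exact dvd_add (this.mul_left _) (Dvd.intro _ rfl)
  · obtain ⟨t, h1, h2, h3, h4⟩ := ht 1 (by omega) (by omega)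
    obtain ⟨s, h1', h2', h3', h4'⟩ := ht 2 (by omega) (by omega)
    have hne : t ≠ s := by
      rintro rfl
      omega
    push_cast at h2 h4 h2' h4'
    constructor
    · intro c hc
      push_cast
      interval_cases c <;> omega
    · intro c hc c' hc' e
      interval_cases c <;> interval_cases c' <;> omega

theorem pred_den (h : SectorShape n m N A Q) : (m : ℤ) - 1 = N * A * Q := by
  rw [h.den_eq]; push_cast; ring

/-- The parameters of a sector with `n = (m - 1)² / d`. -/
theorem mult_mul_sq (h : SectorShape n m N A Q) {d : ℕ}
    (hn : (n : ℚ) = 1 / d * ((m : ℚ) - 1) ^ 2) (hd : 0 < d) : Q * A ^ 2 = d := by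
  have hN : (N : ℚ) ≠ 0 := by have := h.two_le; exact_mod_cast (by omega : N ≠ 0)
  have hQ : (Q : ℚ) ≠ 0 := by exact_mod_cast h.mult_pos.ne'
  have hd' : (d : ℚ) ≠ 0 := by exact_mod_cast hd.ne'
  rw [h.num_eq, h.den_eq] at hn
  push_cast at hn
  field_simp at hn
  have hn' : (Q : ℚ) * A ^ 2 = d :=
    mul_left_cancel₀ (mul_ne_zero (pow_ne_zero 2 hN) hQ) (by linear_combination -hn)
  exact_mod_cast hn'

theorem eq_of_mult_mul_sq (h : SectorShape n m N A Q) {d : ℕ} (hd : 0 < d) (e : Q * A ^ 2 = d) :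
    (n : ℚ) = 1 / d * ((m : ℚ) - 1) ^ 2 := by
  have hd' : (d : ℚ) ≠ 0 := by exact_mod_cast hd.ne'
  have e' : (Q : ℚ) * A ^ 2 = d := by exact_mod_cast e
  rw [h.num_eq, h.den_eq]
  push_cast
  field_simp
  linear_combination (-(N : ℚ) ^ 2 * Q) * e'

end SectorShape

theorem dvd_of_eq_div {n m d : ℕ} (hm : 0 < m) (hd : 0 < d)
    (hn : (n : ℚ) = 1 / d * ((m : ℚ) - 1) ^ 2) : n ∣ (m - 1) ^ 2 := by
  have hd' : (d : ℚ) ≠ 0 := by exact_mod_cast hd.ne'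
  refine ⟨d, ?_⟩
  have : (((m - 1 : ℕ) : ℚ)) ^ 2 = n * d := by
    rw [hn, Nat.cast_sub hm]
    push_cast
    field_simp
  exact_mod_cast this

theorem exists_packing_one_iff {n m : ℕ} (hm : 2 ≤ m) (hmn : m < n) :
    (∃ p, IsPacking (sector ((n : ℝ) / m)) p ∧ IsAscendingStair n m 1 p) ↔
      ((n : ℤ) ∣ ((m : ℤ) - 1) ^ 2 ∧ ((m : ℤ) - 1) ∣ (n : ℤ)) := by
  constructor
  · rintro ⟨p, hpack, hp⟩
    obtain ⟨N, A, Q, r, b, β, δ, h, hr, hb, ht⟩ := exists_shape_and_tiling hm hmn hpack hp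
    obtain ⟨hdvd, -⟩ := ht.initial h.two_le h.mult_pos hr hb
    obtain rfl := eq_of_dvd_sub h.lt (by have := h.two_le; omega) hdvd
    rw [h.pred_den, h.num_eq]
    exact ⟨⟨Q, by push_cast; ring⟩, ⟨N, by push_cast; ring⟩⟩
  · rintro ⟨h1, h2⟩
    have h1' : n ∣ (m - 1) ^ 2 := by
      rw [show (m : ℤ) - 1 = ((m - 1 : ℕ) : ℤ) by omega] at h1
      exact_mod_cast h1
    obtain ⟨N, A, Q, h⟩ := SectorShape.exists hm hmn h1'
    rw [h.pred_den, h.num_eq] at h2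
    have h3 : N * Q * A ∣ N * Q * N := by
      have : ((N * A * Q : ℕ) : ℤ) ∣ ((N ^ 2 * Q : ℕ) : ℤ) := by exact_mod_cast h2
      have := Int.natCast_dvd_natCast.mp this
      convert this using 1 <;> ring
    have h4 : A ∣ N := Nat.dvd_of_mul_dvd_mul_left
      (Nat.mul_pos (by have := h.two_le; omega) h.mult_pos) h3
    obtain rfl : A = 1 := Nat.eq_one_of_dvd_coprimes h.coprime h4 dvd_rfl
    exact h.exists_packing_one

theorem exists_packing_two_iff {n m : ℕ} (hm : 2 ≤ m) (hmn : m < n) :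
    (∃ p, IsPacking (sector ((n : ℝ) / m)) p ∧ IsAscendingStair n m 2 p) ↔
      (m ≡ 9 [MOD 16] ∧ (n : ℚ) = 1 / 16 * ((m : ℚ) - 1) ^ 2) := by
  constructor
  · rintro ⟨p, hpack, hp⟩
    obtain ⟨N, A, Q, r, b, β, δ, h, hr, hb, ht⟩ := exists_shape_and_tiling hm hmn hpack hp
    obtain ⟨hdvd, -⟩ := ht.initial h.two_le h.mult_pos hr hb
    obtain rfl := ht.mult_eq_four h.two_le h.mult_pos hr hb
    have hN := h.two_le
    have hA : A = 2 := by
      rcases (by omega : N = 2 ∨ 2 < N) with rfl | h2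
      · have hA1 : A = 1 := by have := h.lt; have := h.pos; omega
        subst hA1
        norm_num at hdvd
      · exact eq_of_dvd_sub h.lt h2 hdvd
    subst hA
    refine ⟨?_, by exact_mod_cast h.eq_of_mult_mul_sq (d := 16) (by norm_num) (by norm_num)⟩
    have hodd : N % 2 = 1 := Nat.odd_iff.mp (Nat.coprime_two_right.mp h.coprime)
    rw [h.den_eq, Nat.ModEq]
    omega
  · rintro ⟨h1, h2⟩
    obtain ⟨N, A, Q, h⟩ := SectorShape.exists hm hmn
      (dvd_of_eq_div (d := 16) (by omega) (by norm_num) (by exact_mod_cast h2))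
    have h3 := h.mult_mul_sq (d := 16) (by exact_mod_cast h2) (by norm_num)
    have hA : A ≤ 4 := by
      have := h.mult_pos
      by_contra hlt
      nlinarith
    have hpos := h.pos
    rw [h.den_eq, Nat.ModEq] at h1
    interval_cases A
    · obtain rfl : Q = 16 := by omega
      omega
    · obtain rfl : Q = 4 := by omega
      exact h.exists_packing_two
    · omega
    · obtain rfl : Q = 1 := by omega
      have hodd : ¬ 2 ∣ N := fun hd => by
        have := Nat.eq_one_of_dvd_coprimes h.coprime hd (by norm_num)
        omega
      omega

theorem exists_packing_three_iff {n m : ℕ} (hm : 2 ≤ m) (hmn : m < n) (hcop : Nat.Coprime n m) :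
    (∃ p, IsPacking (sector ((n : ℝ) / m)) p ∧ IsAscendingStair n m 3 p) ↔
      (((m ≡ 10 [MOD 27] ∨ m ≡ 19 [MOD 27]) ∧ (n : ℚ) = 1 / 27 * ((m : ℚ) - 1) ^ 2) ∨
        (n : ℚ) / (m : ℚ) = 12 / 7) := by
  constructor
  · rintro ⟨p, hpack, hp⟩
    obtain ⟨N, A, Q, r, b, β, δ, h, hr, hb, ht⟩ := exists_shape_and_tiling hm hmn hpack hp
    obtain ⟨hdvd, -⟩ := ht.initial h.two_le h.mult_pos hr hb
    obtain rfl := ht.mult_eq_three h.two_le h.mult_pos hr hb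
    have hN := h.two_le
    have hlt := h.lt
    have hpos := h.pos
    rcases (by omega : N = 2 ∨ N = 3 ∨ 3 < N) with rfl | rfl | h2
    · right
      obtain rfl : A = 1 := by omega
      rw [h.num_eq, h.den_eq]
      norm_num
    · exfalso
      interval_cases A <;> norm_num at hdvd
    · left
      obtain rfl := eq_of_dvd_sub hlt h2 hdvd
      refine ⟨?_, by exact_mod_cast h.eq_of_mult_mul_sq (d := 27) (by norm_num) (by norm_num)⟩
      have h3 : ¬ 3 ∣ N := fun hd => by
        have := Nat.eq_one_of_dvd_coprimes h.coprime hd dvd_rfl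
        omega
      rw [h.den_eq, Nat.ModEq, Nat.ModEq]
      omega
  · rintro (⟨h1, h2⟩ | h1)
    · obtain ⟨N, A, Q, h⟩ := SectorShape.exists hm hmn
        (dvd_of_eq_div (d := 27) (by omega) (by norm_num) (by exact_mod_cast h2))
      have h3 := h.mult_mul_sq (d := 27) (by exact_mod_cast h2) (by norm_num)
      have hA : A ≤ 5 := by
        have := h.mult_pos
        by_contra hlt
        nlinarith
      have hpos := h.pos
      rw [h.den_eq, Nat.ModEq, Nat.ModEq] at h1
      interval_cases A
      · obtain rfl : Q = 27 := by omega
        omega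
      · omega
      · obtain rfl : Q = 3 := by omega
        exact h.exists_packing_three (by simp) (by norm_num)
      · omega
      · omega
    · have e : n * 7 = 12 * m := by
        have hm' : (m : ℚ) ≠ 0 := by exact_mod_cast (by omega : m ≠ 0)
        rw [div_eq_div_iff hm' (by norm_num)] at h1
        exact_mod_cast h1
      have hn12 : n ∣ 12 := hcop.dvd_of_dvd_mul_right ⟨7, e.symm⟩
      have := Nat.le_of_dvd (by norm_num) hn12
      obtain rfl : n = 12 := by omega
      obtain rfl : m = 7 := by omega
      have h : SectorShape 12 7 2 1 3 :=
        ⟨by norm_num, by norm_num, by norm_num, by norm_num, by norm_num, by norm_num, by norm_num⟩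
      exact h.exists_packing_three (by norm_num) (by norm_num)

end PackingPoly

theorem mainTheorem1 (n m : ℕ) (hcop : Nat.Coprime n m) (hm : m ≠ 1)
    (hnm : (1 : ℝ) < (n : ℝ) / (m : ℝ)) :
    ((∃ p : MvPolynomial (Fin 2) ℝ,
        PackingPoly.IsPacking (PackingPoly.sector ((n : ℝ) / m)) p ∧
          PackingPoly.IsAscendingStair n m 1 p) ↔
      ((n : ℤ) ∣ ((m : ℤ) - 1) ^ 2 ∧ ((m : ℤ) - 1) ∣ (n : ℤ))) ∧
    ((∃ p : MvPolynomial (Fin 2) ℝ,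
        PackingPoly.IsPacking (PackingPoly.sector ((n : ℝ) / m)) p ∧
          PackingPoly.IsAscendingStair n m 2 p) ↔
      (m ≡ 9 [MOD 16] ∧ (n : ℚ) = 1 / 16 * ((m : ℚ) - 1) ^ 2)) ∧
    ((∃ p : MvPolynomial (Fin 2) ℝ,
        PackingPoly.IsPacking (PackingPoly.sector ((n : ℝ) / m)) p ∧
          PackingPoly.IsAscendingStair n m 3 p) ↔
      (((m ≡ 10 [MOD 27] ∨ m ≡ 19 [MOD 27]) ∧ (n : ℚ) = 1 / 27 * ((m : ℚ) - 1) ^ 2) ∨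
        (n : ℚ) / (m : ℚ) = 12 / 7)) ∧
    ¬ ∃ p : MvPolynomial (Fin 2) ℝ,
        PackingPoly.IsPacking (PackingPoly.sector ((n : ℝ) / m)) p ∧
          PackingPoly.IsStair n m 4 p := by
  have hm0 : m ≠ 0 := by
    rintro rfl
    norm_num at hnm
  have hm2 : 2 ≤ m := by omega
  have hmn : m < n := by
    have hm' : (0 : ℝ) < m := by exact_mod_cast Nat.pos_of_ne_zero hm0
    rw [one_lt_div hm'] at hnm
    exact_mod_cast hnm
  refine ⟨PackingPoly.exists_packing_one_iff hm2 hmn, PackingPoly.exists_packing_two_iff hm2 hmn,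
    PackingPoly.exists_packing_three_iff hm2 hmn hcop, ?_⟩
  rintro ⟨p, hpack, hp⟩
  exact PackingPoly.not_packing_four hm2 hmn hpack hp
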